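/- Let $2\le n\le\infty$ and let $\mathcal F_n$ be the unital free semigroup on $n$ generators $z_1,z_2,\dots$ (countably infinitely many if $n=\infty$), with elements called words. Let $\mathcal H_n=\ell_2(\mathcal F_n)$ be the complex Hilbert space with orthonormal basis $\{\xi_w : w\in\mathcal F_n\}$, let $L_i$ be the isometry on $\mathcal H_n$ determined by $L_i\xi_w=\xi_{z_iw}$, and let $\mathfrak L_n$ (the non-commutative analytic Toeplitz algebra) be the unital, weak-operator-closed subalgebra of $\mathcal B(\mathcal H_n)$ generated by the $L_i$. Let $L\in\mathfrak L_n$ be a contraction ($\|L\|\le 1$) which is not unitary, and let $V\in\mathcal B(\mathcal K)$ be its minimal isometric dilation; that is, $\mathcal K\supseteq\mathcal H_n$ is a Hilbert space, $V$ is an isometry, $P_{\mathcal H_n}V^k|_{\mathcal H_n}=L^k$ for all $k\ge 0$, and $\mathcal K$ is the closed linear span of the subspaces $V^k\mathcal H_n$, $k\ge 0$. Then \[ \dim(\mathcal K\ominus V\mathcal K)=\infty . \] Moreover $V$ is a shift with wandering subspace $\mathcal K\ominus V\mathcal K$, that is, $\mathcal K=\bigoplus_{k\ge 0}V^k(\mathcal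 K\ominus V\mathcal K)$ as an orthogonal direct sum; so $V$ is a unilateral shift of infinite multiplicity. -/

import Mathlib

noncomputable section

open scoped InnerProductSpace

/-- The index set of the generators `z_i`: it has exactly `n` elements, and for `n = ⊤` it is
a copy of `ℕ`. -/
abbrev Gens (n : ℕ∞) : Type := {i : ℕ // (i : ℕ∞) < n}

/-- The Fock space `ℓ²(𝓕)`, where `𝓕` is the unital free semigroup on the generators `ι`. -/
abbrev FockSpace (ι : Type*) : Type _ := lp (fun _ : FreeMonoid ι => ℂ) 2

open scoped Classical in
/-- The standard orthonormal basis vector `ξ_w` of the Fock space. -/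
def fockVec {ι : Type*} (w : FreeMonoid ι) : FockSpace ι := lp.single 2 w (1 : ℂ)

theorem fockVec_orthonormal {ι : Type*} :
    Orthonormal ℂ (fockVec : FreeMonoid ι → FockSpace ι) := by
  classical
  rw [orthonormal_iff_ite]
  intro v w
  unfold fockVec
  rw [lp.inner_single_left, lp.single_apply, Pi.single_apply]
  split_ifs <;> simp

/-- For a fixed word `w` the vectors `ξ_{wv}` are orthonormal (left cancellation). -/
theorem fockVec_mul_orthonormal {ι : Type*} (w : FreeMonoid ι) :
    Orthonormal ℂ (fun v : FreeMonoid ι => fockVec (w * v)) :=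
  fockVec_orthonormal.comp (fun v => w * v) (fun _ _ h => mul_left_cancel h)

/-- The isometry `L_w = λ(w)` of the left regular representation: `λ(w) ξ_v = ξ_{wv}`. -/
def leftReg {ι : Type*} (w : FreeMonoid ι) : FockSpace ι →L[ℂ] FockSpace ι :=
  (fockVec_mul_orthonormal w).orthogonalFamily.linearIsometry.toContinuousLinearMap

theorem leftReg_fockVec {ι : Type*} (w v : FreeMonoid ι) :
    leftReg w (fockVec v) = fockVec (w * v) := by
  classical
  have h := (fockVec_mul_orthonormal w).orthogonalFamily.linearIsometry_apply_single
    (i := v) (1 : ℂ)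
  simp only [LinearIsometry.toSpanSingleton_apply, one_smul] at h
  rw [← h]
  unfold leftReg
  simp only [LinearIsometry.coe_toContinuousLinearMap]
  congr 1

/-- The non-commutative analytic Toeplitz algebra: the smallest unital subalgebra of the bounded
operators on the Fock space that is closed in the weak operator topology and contains the
isometries `L_i = λ(z_i)`. -/
def ncToeplitz (ι : Type*) : Subalgebra ℂ (FockSpace ι →L[ℂ] FockSpace ι) :=
  sInf {S | IsClosed ((ContinuousLinearMapWOT.ofCLM :
        (FockSpace ι →L[ℂ] FockSpace ι) → (FockSpace ι →WOT[ℂ] FockSpace ι)) ''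
          (S : Set (FockSpace ι →L[ℂ] FockSpace ι))) ∧
      ∀ i : ι, leftReg (FreeMonoid.of i) ∈ S}

/-- `V` on `K` is a minimal isometric dilation of the operator `T` on `H`, where `H` is regarded as
a subspace of `K` through the isometric embedding `J`: `V` is an isometry, the compression of
`V ^ k` to `H` is `T ^ k` for every `k ≥ 0`, and `K` is the closed linear span of the subspaces
`V ^ k H`, `k ≥ 0`. -/
structure IsMinimalIsometricDilation {H K : Type*}
    [NormedAddCommGroup H] [InnerProductSpace ℂ H] [NormedAddCommGroup K] [InnerProductSpace ℂ K]
    (T : H →L[ℂ] H) (J : H →ₗᵢ[ℂ] K) (V : K →L[ℂ] K) : Prop where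
  isometry : ∀ x : K, ‖V x‖ = ‖x‖
  dilation : ∀ (k : ℕ) (x y : H), ⟪J y, (V ^ k) (J x)⟫_ℂ = ⟪y, (T ^ k) x⟫_ℂ
  minimal : (Submodule.span ℂ {z : K | ∃ (k : ℕ) (x : H), z = (V ^ k) (J x)}).topologicalClosure = ⊤

/-- The isometry `V` on `K` is a (unilateral) shift with wandering subspace `W`: the subspaces
`V ^ k W`, `k ≥ 0`, are pairwise orthogonal and `K` is the Hilbert space direct sum of them. The
multiplicity of the shift is the dimension of `W`. -/
structure IsShiftWith {K : Type*} [NormedAddCommGroup K] [InnerProductSpace ℂ K]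
    (V : K →L[ℂ] K) (W : Submodule ℂ K) : Prop where
  isometry : ∀ x : K, ‖V x‖ = ‖x‖
  wandering : ∀ k l : ℕ, k ≠ l → ∀ x ∈ W, ∀ y ∈ W, ⟪(V ^ k) x, (V ^ l) y⟫_ℂ = 0
  total : (Submodule.span ℂ {z : K | ∃ (k : ℕ) (x : K), x ∈ W ∧ z = (V ^ k) x}).topologicalClosure
    = ⊤

end

/-! An `L` in `ncToeplitz` commutes with right translations, so it is determined by the coefficients
`a_u` of `L ξ_1`, and `L* ξ_w` is the sum of `conj a_u • ξ_v` over the finitely many factorizations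
`w = u v`. Thus `L*` is triangular for word length, with diagonal entry `conj a_1`. A contraction
with `|a_1| = 1` is a unimodular scalar, so `|a_1| < 1` here, and induction on length gives `L*^k →
0` strongly (`nullOrbit_adjoint_eq_top`). This makes `V` a shift (`isShiftWith`).

For the multiplicity, the projection onto the wandering space restricts to a `defect` operator `D`
on `H` with `‖D h‖² = ‖h‖² - ‖L* h‖²`. If that space were finite dimensional, `D ξ_{z^k} → 0` for
each generator `z`, whence `∑_j |a_{z^j}|² = 1`. Two generators share only the coefficient `a_1`, so
`2 ≤ ‖L ξ_1‖² + |a_1|² < 2`, a contradiction (`infinite_multiplicity`). -/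

noncomputable section
open scoped InnerProductSpace
open Filter Topology ContinuousLinearMap

/-! ### Null orbits and minimal isometric dilations of a general operator. -/

section Dilation

variable {H K : Type*}
  [NormedAddCommGroup H] [InnerProductSpace ℂ H] [CompleteSpace H]
  [NormedAddCommGroup K] [InnerProductSpace ℂ K] [CompleteSpace K]

/-- A finite-rank operator sends every orthonormal sequence to a null sequence. -/
theorem Orthonormal.tendsto_norm_apply_zero {E : Type*} [NormedAddCommGroup E]
    [InnerProductSpace ℂ E] [FiniteDimensional ℂ E] {e : ℕ → H} (he : Orthonormal ℂ e)
    (A : H →L[ℂ] E) : Tendsto (fun k => ‖A (e k)‖ ^ 2) atTop (𝓝 0) := by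
  have : CompleteSpace E := FiniteDimensional.complete ℂ E
  let b := stdOrthonormalBasis ℂ E
  -- Parseval in `E`; each term is then null by Bessel's inequality for `e`.
  have hb : ∀ k, ‖A (e k)‖ ^ 2 = ∑ i, ‖⟪e k, (adjoint A) (b i)⟫_ℂ‖ ^ 2 := by
    intro k
    rw [← b.sum_sq_norm_inner_right (A (e k))]
    refine Finset.sum_congr rfl fun i _ => ?_
    rw [adjoint_inner_right, norm_inner_symm]
  simp_rw [hb]
  rw [← Finset.sum_const_zero (s := (Finset.univ : Finset (Fin (Module.finrank ℂ E))))]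
  exact tendsto_finsetSum _ fun i _ => (he.inner_products_summable _).tendsto_atTop_zero

/-- The vectors whose orbit under a contraction tends to zero form a subspace. -/
def nullOrbit (T : H →L[ℂ] H) : Submodule ℂ H where
  carrier := {x | Tendsto (fun k => (T ^ k) x) atTop (𝓝 0)}
  add_mem' {x y} hx hy := by
    have := Tendsto.add hx hy
    simpa using this
  zero_mem' := by simp
  smul_mem' c x hx := by
    have h := Tendsto.const_smul (show Tendsto (fun k => (T ^ k) x) atTop (𝓝 0) from hx) c
    rw [smul_zero] at h
    exact h.congr fun k => (map_smul (T ^ k) c x).symm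

theorem mem_nullOrbit {T : H →L[ℂ] H} {x : H} :
    x ∈ nullOrbit T ↔ Tendsto (fun k => (T ^ k) x) atTop (𝓝 0) := Iff.rfl

theorem norm_pow_apply_le {T : H →L[ℂ] H} (hT : ‖T‖ ≤ 1) (k : ℕ) (x : H) :
    ‖(T ^ k) x‖ ≤ ‖x‖ := by
  induction k with
  | zero => simp
  | succ k ih =>
    rw [pow_succ', mul_apply_eq_comp]
    refine (T.le_of_opNorm_le hT _).trans ?_
    simpa using ih

theorem isClosed_nullOrbit {T : H →L[ℂ] H} (hT : ‖T‖ ≤ 1) :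
    IsClosed (nullOrbit T : Set H) := by
  rw [← closure_subset_iff_isClosed]
  intro x hx
  rw [SetLike.mem_coe, mem_nullOrbit, Metric.tendsto_atTop]
  intro ε hε
  obtain ⟨y, hy, hxy⟩ := Metric.mem_closure_iff.1 hx (ε / 2) (half_pos hε)
  obtain ⟨N, hN⟩ := Metric.tendsto_atTop.1 (mem_nullOrbit.1 hy) (ε / 2) (half_pos hε)
  refine ⟨N, fun k hk => ?_⟩
  have h1 := hN k hk
  have h2 := norm_pow_apply_le hT k (x - y)
  rw [dist_zero_right] at h1 ⊢
  rw [dist_eq_norm] at hxy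
  have h3 : (T ^ k) x = (T ^ k) (x - y) + (T ^ k) y := by simp
  rw [h3]
  linarith [norm_add_le ((T ^ k) (x - y)) ((T ^ k) y)]

/-- If `T x = c x` modulo null orbits with `|c| < 1`, then `x` itself has a null orbit. -/
theorem mem_nullOrbit_of_apply_sub_smul {T : H →L[ℂ] H} {x : H}
    {c : ℂ} (hc : ‖c‖ < 1) (hx : T x - c • x ∈ nullOrbit T) : x ∈ nullOrbit T := by
  rw [mem_nullOrbit] at hx ⊢
  have hstep : ∀ k, (T ^ (k + 1)) x = c • (T ^ k) x + (T ^ k) (T x - c • x) := by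
    intro k
    rw [pow_succ, mul_apply_eq_comp, map_sub, map_smul]
    abel
  rw [Metric.tendsto_atTop] at hx ⊢
  intro ε hε
  -- With this tolerance `δ`, `ε / 2` is the fixed point of `t ↦ ‖c‖ t + δ`.
  have hδ : 0 < (1 - ‖c‖) * (ε / 2) := mul_pos (sub_pos.2 hc) (half_pos hε)
  obtain ⟨N, hN⟩ := hx _ hδ
  have hb : ∀ m, ‖(T ^ (N + m)) x‖ ≤ ‖c‖ ^ m * ‖(T ^ N) x‖ + ε / 2 := by
    intro m
    induction m with
    | zero => simpa using (half_pos hε).le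
    | succ m ih =>
      have h1 := (hN (N + m) (Nat.le_add_right _ _)).le
      rw [dist_zero_right] at h1
      rw [← add_assoc, hstep]
      refine (norm_add_le _ _).trans ?_
      rw [norm_smul]
      have h2 := mul_le_mul_of_nonneg_left ih (norm_nonneg c)
      rw [pow_succ]
      nlinarith
  have hlim : Tendsto (fun m => ‖c‖ ^ m * ‖(T ^ N) x‖) atTop (𝓝 0) := by
    simpa using (tendsto_pow_atTop_nhds_zero_of_lt_one (norm_nonneg c) hc).mul_const ‖(T ^ N) x‖
  obtain ⟨M, hM⟩ := Metric.tendsto_atTop.1 hlim (ε / 2) (half_pos hε)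
  refine ⟨N + M, fun k hk => ?_⟩
  obtain ⟨m, rfl⟩ := Nat.exists_eq_add_of_le ((Nat.le_add_right N M).trans hk)
  have h1 := hM m (by omega)
  rw [Real.dist_eq, sub_zero] at h1
  rw [dist_zero_right]
  linarith [hb m, le_abs_self (‖c‖ ^ m * ‖(T ^ N) x‖)]

namespace IsMinimalIsometricDilation

variable {T : H →L[ℂ] H} {J : H →ₗᵢ[ℂ] K} {V : K →L[ℂ] K}

theorem inner_map_map (hV : IsMinimalIsometricDilation T J V) (x y : K) :
    ⟪V x, V y⟫_ℂ = ⟪x, y⟫_ℂ :=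
  LinearIsometry.inner_map_map ⟨(V : K →ₗ[ℂ] K), hV.isometry⟩ x y

theorem adjoint_apply_apply (hV : IsMinimalIsometricDilation T J V) (x : K) :
    adjoint V (V x) = x :=
  ext_inner_left ℂ fun y => by rw [adjoint_inner_right, hV.inner_map_map]

/-- The space `H` is invariant under `V*`, and `V*` restricts to `T*` there. -/
theorem adjoint_apply_embedding (hV : IsMinimalIsometricDilation T J V) (h : H) :
    adjoint V (J h) = J (adjoint T h) := by
  have hS : (Submodule.span ℂ {z : K | ∃ (k : ℕ) (x : H), z = (V ^ k) (J x)})ᗮ = ⊥ :=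
    (Submodule.topologicalClosure_eq_top_iff).1 hV.minimal
  rw [← sub_eq_zero, ← Submodule.mem_bot ℂ, ← hS, Submodule.mem_orthogonal]
  intro u hu
  induction hu using Submodule.span_induction with
  | mem u hu =>
    obtain ⟨k, x, rfl⟩ := hu
    -- Both pairings reduce to `T ^ (k + 1)`: one by dilation at `k + 1`, the other at `k` after
    -- moving `T*` across.
    rw [inner_sub_right, adjoint_inner_right, sub_eq_zero, ← inner_conj_symm,
      ← inner_conj_symm _ (J (adjoint T h)), hV.dilation k, ← mul_apply_eq_comp, ← pow_succ',
      hV.dilation (k + 1), adjoint_inner_left, pow_succ', mul_apply_eq_comp]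
  | zero => simp
  | add u v _ _ hu hv => rw [inner_add_left, hu, hv, add_zero]
  | smul c u _ hu => rw [inner_smul_left, hu, mul_zero]

theorem adjoint_pow_apply_embedding (hV : IsMinimalIsometricDilation T J V) (k : ℕ) (h : H) :
    (adjoint V ^ k) (J h) = J ((adjoint T ^ k) h) := by
  induction k with
  | zero => simp
  | succ k ih =>
    rw [pow_succ', mul_apply_eq_comp, ih, hV.adjoint_apply_embedding, pow_succ',
      mul_apply_eq_comp]

theorem norm_pow_apply (hV : IsMinimalIsometricDilation T J V) (k : ℕ) (x : K) :
    ‖(V ^ k) x‖ = ‖x‖ := by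
  induction k with
  | zero => simp
  | succ k ih => rw [pow_succ', mul_apply_eq_comp, hV.isometry, ih]

theorem sub_mem_orthogonal_range (hV : IsMinimalIsometricDilation T J V) (x : K) :
    x - V (adjoint V x) ∈ (LinearMap.range (V : K →ₗ[ℂ] K))ᗮ := by
  rw [Submodule.mem_orthogonal]
  rintro _ ⟨y, rfl⟩
  change ⟪V y, _⟫_ℂ = 0
  rw [inner_sub_right, hV.inner_map_map, adjoint_inner_right, sub_self]

/-- The compression to `H` of the projection onto the wandering subspace is `1 - T T*`. -/
theorem norm_sub_sq (hV : IsMinimalIsometricDilation T J V) (h : H) :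
    ‖J h - V (adjoint V (J h))‖ ^ 2 = ‖h‖ ^ 2 - ‖adjoint T h‖ ^ 2 := by
  have h0 : ⟪V (adjoint V (J h)), J h - V (adjoint V (J h))⟫_ℂ = 0 :=
    (Submodule.mem_orthogonal _ _).1 (hV.sub_mem_orthogonal_range (J h)) _ ⟨_, rfl⟩
  have h1 := norm_add_sq_eq_norm_sq_add_norm_sq_of_inner_eq_zero _ _ h0
  rw [add_sub_cancel, hV.isometry, hV.adjoint_apply_embedding, J.norm_map, J.norm_map] at h1
  rw [hV.adjoint_apply_embedding]
  nlinarith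

/-- The compression to `H` of the projection onto the wandering subspace. -/
def defect (hV : IsMinimalIsometricDilation T J V) :
    H →L[ℂ] ((LinearMap.range (V : K →ₗ[ℂ] K))ᗮ : Submodule ℂ K) :=
  ((ContinuousLinearMap.id ℂ K - V ∘L adjoint V) ∘L J.toContinuousLinearMap).codRestrict _
    fun h => hV.sub_mem_orthogonal_range (J h)

theorem norm_defect_sq (hV : IsMinimalIsometricDilation T J V) (h : H) :
    ‖hV.defect h‖ ^ 2 = ‖h‖ ^ 2 - ‖adjoint T h‖ ^ 2 :=
  hV.norm_sub_sq h

theorem inner_pow_pow_of_lt (hV : IsMinimalIsometricDilation T J V) {k l : ℕ} (hkl : k < l)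
    {x : K} (hx : x ∈ (LinearMap.range (V : K →ₗ[ℂ] K))ᗮ) (y : K) :
    ⟪(V ^ k) x, (V ^ l) y⟫_ℂ = 0 := by
  induction k generalizing l with
  | zero =>
    obtain ⟨l, rfl⟩ := Nat.exists_eq_add_of_lt hkl
    rw [pow_zero, one_apply_eq_self, pow_succ', mul_apply_eq_comp, ← inner_conj_symm,
      (Submodule.mem_orthogonal _ _).1 hx (V _) ⟨_, rfl⟩, map_zero]
  | succ k ih =>
    obtain ⟨l, rfl⟩ : ∃ m, l = m + 1 := ⟨l - 1, by omega⟩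
    rw [pow_succ', pow_succ', mul_apply_eq_comp, mul_apply_eq_comp, hV.inner_map_map]
    exact ih (by omega)

/-- The minimal isometric dilation of an operator whose adjoint has null orbits is a shift. -/
theorem isShiftWith (hV : IsMinimalIsometricDilation T J V) (hT : nullOrbit (adjoint T) = ⊤) :
    IsShiftWith V (LinearMap.range (V : K →ₗ[ℂ] K))ᗮ where
  isometry := hV.isometry
  wandering k l hkl x hx y hy := by
    rcases lt_or_gt_of_ne hkl with h | h
    · exact hV.inner_pow_pow_of_lt h hx y
    · rw [← inner_conj_symm, hV.inner_pow_pow_of_lt h hy x, map_zero]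
  total := by
    set W := (LinearMap.range (V : K →ₗ[ℂ] K))ᗮ
    set S := Submodule.span ℂ {z : K | ∃ (k : ℕ) (x : K), x ∈ W ∧ z = (V ^ k) x}
    have hW : ∀ (k : ℕ) (x : K), (V ^ k) (x - V (adjoint V x)) ∈ S := fun k x =>
      Submodule.subset_span ⟨k, _, hV.sub_mem_orthogonal_range x, rfl⟩
    -- Telescoping sum of the vectors `V^(k+j) (1 - V V*) V*^j x` for `j < m`.
    have hsub : ∀ (x : K) (k m : ℕ), (V ^ k) x - (V ^ (k + m)) ((adjoint V ^ m) x) ∈ S := by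
      intro x k m
      induction m with
      | zero => simp
      | succ m ih =>
        have h1 := S.add_mem ih (hW (k + m) ((adjoint V ^ m) x))
        convert h1 using 1
        rw [map_sub, ← add_assoc, pow_succ V, pow_succ' (adjoint V), mul_apply_eq_comp,
          mul_apply_eq_comp]
        abel
    rw [eq_top_iff, ← hV.minimal]
    refine Submodule.topologicalClosure_minimal _ (Submodule.span_le.2 ?_)
      S.isClosed_topologicalClosure
    rintro _ ⟨k, x, rfl⟩
    have hx : Tendsto (fun m => (adjoint T ^ m) x) atTop (𝓝 0) :=
      mem_nullOrbit.1 (hT ▸ Submodule.mem_top)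
    have hlim : Tendsto (fun m => (V ^ (k + m)) ((adjoint V ^ m) (J x))) atTop (𝓝 0) := by
      rw [tendsto_zero_iff_norm_tendsto_zero] at hx ⊢
      refine hx.congr fun m => ?_
      rw [hV.norm_pow_apply, hV.adjoint_pow_apply_embedding, J.norm_map]
    have hlim' := hlim.const_sub ((V ^ k) (J x))
    rw [sub_zero] at hlim'
    exact mem_closure_of_tendsto hlim' (Eventually.of_forall fun m => hsub (J x) k m)

end IsMinimalIsometricDilation

end Dilation

/-! ### Fock space, Fourier coefficients and the adjoint of `L`. -/

section Fock

variable {ι : Type*}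

theorem inner_fockVec_left (w : FreeMonoid ι) (x : FockSpace ι) : ⟪fockVec w, x⟫_ℂ = x w := by
  classical
  unfold fockVec
  rw [lp.inner_single_left]
  simp

theorem hasSum_fockVec (x : FockSpace ι) : HasSum (fun w => x w • fockVec w) x := by
  classical
  convert lp.hasSum_single (p := 2) (by norm_num) x using 2 with w
  unfold fockVec
  rw [← lp.single_smul, smul_eq_mul, mul_one]

theorem hasSum_norm_sq (x : FockSpace ι) : HasSum (fun w => ‖x w‖ ^ 2) (‖x‖ ^ 2) := by
  simpa using lp.hasSum_norm (p := 2) (by norm_num) x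

@[simp]
theorem norm_fockVec (w : FreeMonoid ι) : ‖fockVec w‖ = 1 := fockVec_orthonormal.1 w

theorem fockVec_apply_self (w : FreeMonoid ι) : fockVec w w = 1 := by
  rw [← inner_fockVec_left, inner_self_eq_norm_sq_to_K, norm_fockVec]
  simp

theorem fockVec_apply_of_ne {v w : FreeMonoid ι} (h : v ≠ w) : fockVec w v = 0 := by
  rw [← inner_fockVec_left]
  exact fockVec_orthonormal.2 h

theorem clm_ext_fockVec {S T : FockSpace ι →L[ℂ] FockSpace ι}
    (h : ∀ w, S (fockVec w) = T (fockVec w)) : S = T := by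
  ext1 x
  have hS := (hasSum_fockVec x).mapL S
  have hT := (hasSum_fockVec x).mapL T
  simp only [map_smul, h] at hS hT
  exact hS.unique hT

theorem fockVec_mul_right_orthonormal (w : FreeMonoid ι) :
    Orthonormal ℂ (fun v : FreeMonoid ι => fockVec (v * w)) :=
  fockVec_orthonormal.comp (fun v => v * w) (fun _ _ h => mul_right_cancel h)

/-- The isometry `ρ(w)` of the right regular representation: `ρ(w) ξ_v = ξ_{vw}`. -/
def rightReg (w : FreeMonoid ι) : FockSpace ι →L[ℂ] FockSpace ι :=
  (fockVec_mul_right_orthonormal w).orthogonalFamily.linearIsometry.toContinuousLinearMap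

theorem rightReg_fockVec (w v : FreeMonoid ι) :
    rightReg w (fockVec v) = fockVec (v * w) := by
  classical
  have h := (fockVec_mul_right_orthonormal w).orthogonalFamily.linearIsometry_apply_single
    (i := v) (1 : ℂ)
  simp only [LinearIsometry.toSpanSingleton_apply, one_smul] at h
  rw [← h]
  unfold rightReg
  simp only [LinearIsometry.coe_toContinuousLinearMap]
  congr 1

theorem hasSum_rightReg (w : FreeMonoid ι) (x : FockSpace ι) :
    HasSum (fun v => x v • fockVec (v * w)) (rightReg w x) := by
  simpa only [map_smul, rightReg_fockVec] using (hasSum_fockVec x).mapL (rightReg w)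

theorem hasSum_rightReg_apply (w v : FreeMonoid ι) (x : FockSpace ι) :
    HasSum (fun u => x u * fockVec (u * w) v) ((rightReg w x) v) := by
  have h := (hasSum_rightReg w x).mapL (innerSL ℂ (fockVec v))
  simpa only [innerSL_apply_apply, inner_smul_right, inner_fockVec_left] using h

theorem rightReg_apply_mul (w u : FreeMonoid ι) (x : FockSpace ι) :
    (rightReg w x) (u * w) = x u := by
  have h := hasSum_rightReg_apply w (u * w) x
  have h' := hasSum_single (f := fun t => x t * fockVec (t * w) (u * w)) u fun t ht => by
    rw [fockVec_apply_of_ne fun h => ht (mul_right_cancel h).symm, mul_zero]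
  rw [h.unique h', fockVec_apply_self, mul_one]

theorem rightReg_apply_of_forall_ne {w v : FreeMonoid ι} (hv : ∀ u, v ≠ u * w)
    (x : FockSpace ι) : (rightReg w x) v = 0 := by
  have h := hasSum_rightReg_apply w v x
  simp only [fockVec_apply_of_ne (hv _), mul_zero] at h
  exact h.unique hasSum_zero

/-- Elements of the non-commutative analytic Toeplitz algebra commute with the right regular
representation. -/
theorem ncToeplitz_commute {L : FockSpace ι →L[ℂ] FockSpace ι} (hL : L ∈ ncToeplitz ι)
    (w : FreeMonoid ι) (x : FockSpace ι) : L (rightReg w x) = rightReg w (L x) := by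
  have hle : ncToeplitz ι ≤ Subalgebra.centralizer ℂ (Set.range rightReg) := by
    refine sInf_le ⟨?_, fun i => ?_⟩
    -- Moving `rightReg w` to the other side as an adjoint expresses commutation through matrix
    -- coefficients of `A`, which are WOT-continuous.
    · have himage : (ContinuousLinearMapWOT.ofCLM :
          (FockSpace ι →L[ℂ] FockSpace ι) → (FockSpace ι →WOT[ℂ] FockSpace ι)) ''
          (Subalgebra.centralizer ℂ (Set.range (rightReg (ι := ι))) :
            Set (FockSpace ι →L[ℂ] FockSpace ι)) =
          ⋂ (w : FreeMonoid ι) (x : FockSpace ι) (y : FockSpace ι),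
            {A | ⟪adjoint (rightReg w) y, A x⟫_ℂ = ⟪y, A (rightReg w x)⟫_ℂ} := by
        ext A
        simp only [Set.mem_iInter, Set.mem_ofPred_eq]
        constructor
        · rintro ⟨B, hB, rfl⟩ w x y
          have h := (Subalgebra.mem_centralizer_iff ℂ).1 hB (rightReg w) ⟨w, rfl⟩
          rw [adjoint_inner_left]
          exact congrArg _ (DFunLike.congr_fun h x)
        · intro h
          refine ⟨A.toCLM, (Subalgebra.mem_centralizer_iff ℂ).2 ?_, rfl⟩
          rintro _ ⟨w, rfl⟩
          refine ContinuousLinearMap.ext fun x => ext_inner_left ℂ fun y => ?_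
          have hy := h w x y
          rw [adjoint_inner_left] at hy
          exact hy
      rw [himage]
      refine isClosed_iInter fun w => isClosed_iInter fun x => isClosed_iInter fun y =>
        isClosed_eq ?_ ?_
      · exact ContinuousLinearMapWOT.continuous_inner_apply continuous_id _ _
      · exact ContinuousLinearMapWOT.continuous_inner_apply continuous_id _ _
    · rw [Subalgebra.mem_centralizer_iff]
      rintro _ ⟨w, rfl⟩
      refine clm_ext_fockVec fun v => ?_
      simp only [mul_apply_eq_comp, leftReg_fockVec, rightReg_fockVec, mul_assoc]
  have h := (Subalgebra.mem_centralizer_iff ℂ).1 (hle hL) (rightReg w) ⟨w, rfl⟩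
  exact (DFunLike.congr_fun h x).symm

variable {L : FockSpace ι →L[ℂ] FockSpace ι}

theorem ncToeplitz_apply_fockVec (hL : L ∈ ncToeplitz ι) (w : FreeMonoid ι) :
    L (fockVec w) = rightReg w (L (fockVec 1)) := by
  rw [← ncToeplitz_commute hL, rightReg_fockVec, one_mul]

theorem adjoint_fockVec_apply (L : FockSpace ι →L[ℂ] FockSpace ι) (v w : FreeMonoid ι) :
    adjoint L (fockVec w) v = (starRingEnd ℂ) (L (fockVec v) w) := by
  rw [← inner_fockVec_left, adjoint_inner_right, ← inner_conj_symm, inner_fockVec_left]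

theorem adjoint_fockVec_mul_apply (hL : L ∈ ncToeplitz ι) (u v : FreeMonoid ι) :
    adjoint L (fockVec (u * v)) v = (starRingEnd ℂ) (L (fockVec 1) u) := by
  rw [adjoint_fockVec_apply, ncToeplitz_apply_fockVec hL, rightReg_apply_mul]

theorem adjoint_fockVec_apply_of_forall_ne (hL : L ∈ ncToeplitz ι) {v w : FreeMonoid ι}
    (h : ∀ u, w ≠ u * v) : adjoint L (fockVec w) v = 0 := by
  rw [adjoint_fockVec_apply, ncToeplitz_apply_fockVec hL, rightReg_apply_of_forall_ne h, map_zero]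

theorem norm_apply_fockVec_le (hc : ‖L‖ ≤ 1) (w : FreeMonoid ι) : ‖L (fockVec w)‖ ≤ 1 := by
  simpa using L.le_of_opNorm_le hc (fockVec w)

/-- The Fourier coefficient at the empty word of a non-unitary contraction is less than one. -/
theorem norm_coeff_one_lt (hL : L ∈ ncToeplitz ι) (hc : ‖L‖ ≤ 1)
    (hu : L ∉ unitary (FockSpace ι →L[ℂ] FockSpace ι)) : ‖L (fockVec 1) 1‖ < 1 := by
  by_contra! hge
  set c := L (fockVec 1) 1 with hcdef
  have hx := norm_apply_fockVec_le hc (1 : FreeMonoid ι)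
  have hsum := hasSum_norm_sq (L (fockVec 1))
  -- The coefficient at the empty word already exhausts `‖L ξ_1‖ ≤ 1`, so all others vanish and `L`
  -- is scalar.
  have hc1 : ‖c‖ = 1 := by
    refine le_antisymm ?_ hge
    have h := le_hasSum hsum 1 fun _ _ => sq_nonneg _
    rw [← hcdef] at h
    nlinarith [norm_nonneg c, norm_nonneg (L (fockVec 1))]
  have hzero : ∀ w, w ≠ 1 → L (fockVec 1) w = 0 := by
    classical
    intro w hw
    have h := sum_le_hasSum {1, w} (fun _ _ => sq_nonneg _) hsum
    rw [Finset.sum_pair hw.symm, ← hcdef, hc1] at h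
    have h0 : ‖L (fockVec 1) w‖ ^ 2 ≤ 0 := by nlinarith [norm_nonneg (L (fockVec 1))]
    exact norm_eq_zero.1 (pow_eq_zero_iff two_ne_zero |>.1 (le_antisymm h0 (sq_nonneg _)))
  have hone : L (fockVec 1) = c • fockVec 1 :=
    (hasSum_fockVec (L (fockVec 1))).unique
      (hasSum_single 1 fun w hw => by rw [hzero w hw, zero_smul])
  have hLc : L = c • (1 : FockSpace ι →L[ℂ] FockSpace ι) := by
    refine clm_ext_fockVec fun w => ?_
    rw [ncToeplitz_apply_fockVec hL, hone, map_smul, rightReg_fockVec, one_mul]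
    rfl
  apply hu
  have hcc : (starRingEnd ℂ) c * c = 1 := by
    rw [RCLike.conj_mul, hc1]
    simp
  rw [hLc, Unitary.mem_iff]
  simp only [star_smul, star_one, smul_mul_smul_comm, mul_one]
  refine ⟨?_, ?_⟩
  · rw [show star c * c = 1 from hcc, one_smul]
  · rw [mul_comm, show star c * c = 1 from hcc, one_smul]

/-- The adjoint of a non-unitary contraction in the non-commutative analytic Toeplitz algebra has
powers converging strongly to zero. -/
theorem nullOrbit_adjoint_eq_top (hL : L ∈ ncToeplitz ι) (hc : ‖L‖ ≤ 1)
    (hu : L ∉ unitary (FockSpace ι →L[ℂ] FockSpace ι)) : nullOrbit (adjoint L) = ⊤ := by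
  have hclosed : IsClosed (nullOrbit (adjoint L) : Set (FockSpace ι)) :=
    isClosed_nullOrbit (by rwa [LinearIsometryEquiv.norm_map])
  have hmem : ∀ x : FockSpace ι, (∀ w, x w ≠ 0 → fockVec w ∈ nullOrbit (adjoint L)) →
      x ∈ nullOrbit (adjoint L) := by
    intro x hx
    refine hclosed.mem_of_tendsto (hasSum_fockVec x)
      (Eventually.of_forall fun s => Submodule.sum_mem _ fun w _ => ?_)
    by_cases hw : x w = 0
    · rw [hw, zero_smul]
      exact Submodule.zero_mem _
    · exact Submodule.smul_mem _ _ (hx w hw)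
  have hbasis : ∀ (m : ℕ) (w : FreeMonoid ι), w.length = m →
      fockVec w ∈ nullOrbit (adjoint L) := by
    intro m
    induction m using Nat.strong_induction_on with
    | _ m ih =>
      intro w hw
      -- Without its diagonal term, `L* ξ_w` is supported on proper suffixes of `w`, which the
      -- induction covers.
      refine mem_nullOrbit_of_apply_sub_smul (c := (starRingEnd ℂ) (L (fockVec 1) 1))
        (by rw [RCLike.norm_conj]; exact norm_coeff_one_lt hL hc hu) (hmem _ fun v hv => ?_)
      refine ih _ ?_ v rfl
      by_contra! hlen
      apply hv
      change adjoint L (fockVec w) v - _ * fockVec w v = 0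
      by_cases hvw : v = w
      · subst hvw
        have h := adjoint_fockVec_mul_apply hL 1 v
        rw [one_mul] at h
        rw [h, fockVec_apply_self, mul_one, sub_self]
      · rw [fockVec_apply_of_ne hvw, mul_zero, sub_zero]
        refine adjoint_fockVec_apply_of_forall_ne hL fun u huv => hvw ?_
        have h := congrArg FreeMonoid.length huv
        rw [FreeMonoid.length_mul] at h
        have hu0 : u = 1 := FreeMonoid.length_eq_zero.1 (by omega)
        rw [huv, hu0, one_mul]
  exact eq_top_iff.2 fun x _ => hmem x fun w _ => hbasis _ w rfl

/-! ### Powers of two generators and infinite multiplicity. -/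

/-- The word `z ^ k`. -/
def powWord (z : ι) : ℕ ↪ FreeMonoid ι where
  toFun k := FreeMonoid.ofList (List.replicate k z)
  inj' k l h := by
    have h' := congrArg (fun w => (FreeMonoid.toList w).length) h
    simpa using h'

theorem powWord_zero (z : ι) : powWord z 0 = 1 := rfl

theorem powWord_eq_mul_iff {z : ι} {k : ℕ} {u v : FreeMonoid ι} :
    powWord z k = u * v ↔ ∃ i j, i + j = k ∧ u = powWord z i ∧ v = powWord z j := by
  constructor
  · intro h
    have h' : u.toList ++ v.toList = List.replicate k z := (congrArg FreeMonoid.toList h).symm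
    obtain ⟨h1, h2, h3⟩ := List.append_eq_replicate_iff.1 h'
    exact ⟨_, _, h1, congrArg FreeMonoid.ofList h2, congrArg FreeMonoid.ofList h3⟩
  · rintro ⟨i, j, rfl, rfl, rfl⟩
    exact congrArg FreeMonoid.ofList List.replicate_append_replicate.symm

theorem powWord_ne {z z' : ι} (h : z ≠ z') (j k : ℕ) : powWord z j ≠ powWord z' (k + 1) := by
  intro h'
  have h1 : List.replicate j z = List.replicate (k + 1) z' := congrArg FreeMonoid.toList h'
  have h2 : z' ∈ List.replicate j z := by
    rw [h1]
    simp
  exact h (List.eq_of_mem_replicate h2).symm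

/-- Every factorization of `z^k` is `z^j z^(k-j)`; reflecting the sum indexes it by the prefix
instead of the suffix. -/
theorem norm_sq_adjoint_powWord (hL : L ∈ ncToeplitz ι) (z : ι) (k : ℕ) :
    ‖adjoint L (fockVec (powWord z k))‖ ^ 2 =
      ∑ j ∈ Finset.range (k + 1), ‖L (fockVec 1) (powWord z j)‖ ^ 2 := by
  have h := hasSum_norm_sq (adjoint L (fockVec (powWord z k)))
  rw [h.unique (hasSum_sum_of_ne_finset_zero (s := (Finset.range (k + 1)).map (powWord z)) ?_),
    Finset.sum_map, ← Finset.sum_range_reflect]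
  · refine Finset.sum_congr rfl fun j hj => ?_
    have hj' := Finset.mem_range.1 hj
    have hk : powWord z k = powWord z j * powWord z (k + 1 - 1 - j) :=
      powWord_eq_mul_iff.2 ⟨_, _, by omega, rfl, rfl⟩
    rw [hk, adjoint_fockVec_mul_apply hL, RCLike.norm_conj]
  · intro v hv
    rw [adjoint_fockVec_apply_of_forall_ne hL, norm_zero, zero_pow two_ne_zero]
    intro u hu
    obtain ⟨i, j, hij, -, rfl⟩ := powWord_eq_mul_iff.1 hu
    exact hv (Finset.mem_map_of_mem _ (Finset.mem_range.2 (by omega)))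

theorem norm_sq_adjoint_powWord_add_le (hL : L ∈ ncToeplitz ι) (hc : ‖L‖ ≤ 1) {z z' : ι}
    (hz : z ≠ z') (k : ℕ) :
    ‖adjoint L (fockVec (powWord z k))‖ ^ 2 + ‖adjoint L (fockVec (powWord z' k))‖ ^ 2 ≤
      1 + ‖L (fockVec 1) 1‖ ^ 2 := by
  have hx := norm_apply_fockVec_le hc (1 : FreeMonoid ι)
  -- The shift by one omits `z'^0`, so the empty word is counted once; its second occurrence is the
  -- extra term on the right.
  have hdisj : Disjoint ((Finset.range (k + 1)).map (powWord z))
      ((Finset.range k).map ((addRightEmbedding 1).trans (powWord z'))) := by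
    rw [Finset.disjoint_left]
    intro w hw hw'
    obtain ⟨i, -, rfl⟩ := Finset.mem_map.1 hw
    obtain ⟨j, -, h⟩ := Finset.mem_map.1 hw'
    exact powWord_ne hz i j h.symm
  have h := sum_le_hasSum (Finset.disjUnion _ _ hdisj) (fun _ _ => sq_nonneg _)
    (hasSum_norm_sq (L (fockVec 1)))
  rw [Finset.sum_disjUnion, Finset.sum_map, Finset.sum_map] at h
  simp only [Function.Embedding.trans_apply, addRightEmbedding_apply] at h
  rw [norm_sq_adjoint_powWord hL, norm_sq_adjoint_powWord hL,
    Finset.sum_range_succ' (fun j => ‖L (fockVec 1) (powWord z' j)‖ ^ 2), powWord_zero]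
  nlinarith [norm_nonneg (L (fockVec 1))]

theorem infinite_multiplicity (hL : L ∈ ncToeplitz ι) (hc : ‖L‖ ≤ 1)
    (hu : L ∉ unitary (FockSpace ι →L[ℂ] FockSpace ι)) [Nontrivial ι]
    {K : Type*} [NormedAddCommGroup K] [InnerProductSpace ℂ K] [CompleteSpace K]
    {J : FockSpace ι →ₗᵢ[ℂ] K} {V : K →L[ℂ] K} (hV : IsMinimalIsometricDilation L J V) :
    ¬ FiniteDimensional ℂ ((LinearMap.range (V : K →ₗ[ℂ] K))ᗮ : Submodule ℂ K) := by
  intro hfin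
  obtain ⟨z, z', hz⟩ := exists_pair_ne ι
  have ht : ∀ y : ι, Tendsto (fun k => ‖hV.defect (fockVec (powWord y k))‖ ^ 2) atTop (𝓝 0) :=
    fun y => (fockVec_orthonormal.comp _ (powWord y).injective).tendsto_norm_apply_zero hV.defect
  have hsum := (ht z).add (ht z')
  rw [add_zero] at hsum
  -- The two squared defects sum to at least `2 - (1 + |a_1|²)`, yet tend to `0`.
  have hle := ge_of_tendsto (b := 1 - ‖L (fockVec 1) 1‖ ^ 2) hsum <|
    Eventually.of_forall fun k => by
      rw [hV.norm_defect_sq, hV.norm_defect_sq, norm_fockVec, norm_fockVec]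
      linarith [norm_sq_adjoint_powWord_add_le hL hc hz k]
  nlinarith [norm_coeff_one_lt hL hc hu, norm_nonneg (L (fockVec 1) 1)]

end Fock

end

theorem theorem1p10 (n : ℕ∞) (hn : 2 ≤ n)
    (L : FockSpace (Gens n) →L[ℂ] FockSpace (Gens n))
    (hL : L ∈ ncToeplitz (Gens n)) (hcontr : ‖L‖ ≤ 1)
    (hnonunitary : L ∉ unitary (FockSpace (Gens n) →L[ℂ] FockSpace (Gens n)))
    {K : Type*} [NormedAddCommGroup K] [InnerProductSpace ℂ K] [CompleteSpace K]
    (J : FockSpace (Gens n) →ₗᵢ[ℂ] K) (V : K →L[ℂ] K)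
    (hV : IsMinimalIsometricDilation L J V) :
    ¬ FiniteDimensional ℂ ((LinearMap.range (V : K →ₗ[ℂ] K))ᗮ : Submodule ℂ K) ∧
      IsShiftWith V (LinearMap.range (V : K →ₗ[ℂ] K))ᗮ := by
  have h0 : ((0 : ℕ) : ℕ∞) < n := lt_of_lt_of_le (by norm_num) hn
  have h1 : ((1 : ℕ) : ℕ∞) < n := lt_of_lt_of_le (by norm_num) hn
  have : Nontrivial (Gens n) := ⟨⟨⟨0, h0⟩, ⟨1, h1⟩, fun h => zero_ne_one (congrArg Subtype.val h)⟩⟩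
  exact ⟨infinite_multiplicity hL hcontr hnonunitary hV,
    hV.isShiftWith (nullOrbit_adjoint_eq_top hL hcontr hnonunitary)⟩
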